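/- Let $m\ge 1$ and $n\ge 0$ be integers. Let $K_n$ be the complete graph on $n$ vertices ($K_0$ being the empty graph), and let its generalized cone $C^mK_n$ be the multigraph obtained from $K_n$ by adding one new vertex $p$ and, for each vertex $v$ of $K_n$, $m$ parallel edges joining $p$ to $v$. Let $t(G)$ denote the number of spanning trees of a finite multigraph $G$, where parallel edges are regarded as distinct, so that spanning trees with different edge sets are counted separately. Then $$t(C^mK_n)=m\,(m+n)^{n-1}.$$ For $n=0$ the right-hand side is the rational number $m\cdot m^{-1}=1$. -/

import Mathlib

namespace Graph

/-- A multigraph is connected if it has at least one vertex and any two of its vertices are joined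
by a sequence of successively adjacent vertices. -/
def IsConnected {α β : Type*} (G : Graph α β) : Prop :=
  G.vertexSet.Nonempty ∧
    ∀ x ∈ G.vertexSet, ∀ y ∈ G.vertexSet, Relation.ReflTransGen G.Adj x y

/-- The vertices `v 0, …, v k` and the edges `e 0, …, e k` form a cycle of length `k + 1`: the
vertices are pairwise distinct, the edges are pairwise distinct, and `e i` joins `v i` to
`v (i + 1)`, the indices being taken cyclically (addition in `Fin (k + 1)` is modulo `k + 1`).
A loop is a cycle of length `1`, two parallel edges form a cycle of length `2`. -/
def IsCycleOn {α β : Type*} (G : Graph α β) (k : ℕ) (v : Fin (k + 1) → α)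
    (e : Fin (k + 1) → β) : Prop :=
  Function.Injective v ∧ Function.Injective e ∧ ∀ i, G.IsLink (e i) (v i) (v (i + 1))

/-- A multigraph is acyclic if it contains no cycle (in particular no loop and no pair of parallel
edges). -/
def IsAcyclic {α β : Type*} (G : Graph α β) : Prop :=
  ∀ (k : ℕ) (v : Fin (k + 1) → α) (e : Fin (k + 1) → β), ¬ G.IsCycleOn k v e

/-- A tree is a connected acyclic graph. -/
def IsTree {α β : Type*} (G : Graph α β) : Prop :=
  G.IsConnected ∧ G.IsAcyclic

/-- `T` is a spanning tree of `G`: a subgraph with the same vertex set which is a tree. -/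
def IsSpanningTreeOf {α β : Type*} (T G : Graph α β) : Prop :=
  T.IsSpanningSubgraph G ∧ T.IsTree

/-- The number `t(G)` of spanning trees of `G`. Parallel edges are different edges, so spanning
trees that differ by the choice of parallel edges are counted separately. -/
noncomputable def numSpanningTrees {α β : Type*} (G : Graph α β) : ℕ :=
  {T : Graph α β | T.IsSpanningTreeOf G}.ncard

/-- The generalized cone `C^m G`: add to `G` a new vertex `none` and, for each vertex `a` of `G`,
`m` parallel edges `Sum.inr (a, 0), …, Sum.inr (a, m - 1)` between the new vertex and `a`.
The vertices and edges of `G` are kept, as `some a` and `Sum.inl e`. -/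
def generalizedCone {α β : Type*} (m : ℕ) (G : Graph α β) :
    Graph (Option α) (β ⊕ (α × Fin m)) where
  vertexSet := insert none (some '' G.vertexSet)
  IsLink := fun f x y => match f with
    | Sum.inl e => ∃ a b, G.IsLink e a b ∧ x = some a ∧ y = some b
    | Sum.inr (a, _) =>
        a ∈ G.vertexSet ∧ ((x = none ∧ y = some a) ∨ (x = some a ∧ y = none))
  isLink_symm := by
    rintro (e | ⟨a, i⟩) -
    · exact ⟨fun x y ⟨a, b, h, hx, hy⟩ => ⟨b, a, h.symm, hy, hx⟩⟩
    · exact ⟨fun x y ⟨ha, h⟩ => ⟨ha, h.symm.imp (fun h => ⟨h.2, h.1⟩) (fun h => ⟨h.2, h.1⟩)⟩⟩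
  eq_or_eq_of_isLink_of_isLink := by
    rintro (e | ⟨a, i⟩) x y v w
    · rintro ⟨a, b, h, rfl, rfl⟩ ⟨c, d, h', rfl, rfl⟩
      simpa using h.left_eq_or_eq h'
    · rintro ⟨-, h⟩ ⟨-, h'⟩
      rcases h with ⟨rfl, rfl⟩ | ⟨rfl, rfl⟩ <;> rcases h' with ⟨rfl, rfl⟩ | ⟨rfl, rfl⟩ <;> simp
  left_mem_of_isLink := by
    rintro (e | ⟨a, i⟩) x y
    · rintro ⟨a, b, h, rfl, rfl⟩
      exact Or.inr ⟨a, h.left_mem, rfl⟩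
    · rintro ⟨ha, ⟨rfl, rfl⟩ | ⟨rfl, rfl⟩⟩
      · exact Or.inl rfl
      · exact Or.inr ⟨a, ha, rfl⟩

/-- The complete graph `K_n` on the `n` vertices `0, …, n - 1`, each edge being the unordered pair
of its two distinct ends. -/
def completeGraphOn (n : ℕ) : Graph (Fin n) (Sym2 (Fin n)) :=
  Graph.ofSimpleGraph (⊤ : SimpleGraph (Fin n))

end Graph

/-!
Orient every spanning tree of the cone towards the apex. Each vertex of `K_n` is then assigned its
parent, which is another vertex of `K_n` or one of the `m` edges to the apex, so that a spanning
tree becomes a function `Fin n → Fin n ⊕ Fin m` whose iteration from any vertex ends in `Fin m`.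
This is a bijection (`Graph.numSpanningTrees_cone_completeGraphOn`): such an acyclic function gives
a tree (`Graph.IsParentStructure.isTree`), it can be recovered from the tree
(`Graph.eq_of_parentGraph_eq`), and in a spanning tree the edges that decrease the distance to the
apex are all the edges, since a further one would close a cycle
(`Graph.IsParentStructure.exists_eq_some_of_isAcyclic`).

The number `N(n, r)` of acyclic functions on `n` vertices with `r` roots is found by induction
(`card_isAcyclicParent_mul`). If `j` vertices are children of roots, the remaining `n - j` vertices
carry an acyclic function with these `j` vertices as roots (`glueParent_bijective`), so
`N(n, r) = ∑ j, (n choose j) * r ^ j * N(n - j, j)`. Inserting `N(n - j, j) = j * n ^ (n - j - 1)`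
and `j * (n choose j) = n * (n - 1 choose j - 1)`, the binomial theorem yields
`N(n, r) = r * (r + n) ^ (n - 1)`.
-/

/-! ### Counting acyclic parent functions -/

/-- A parent function `f : V → V ⊕ R` sends each vertex either to another vertex (its parent) or
to one of the roots in `R`. It is acyclic, i.e. iterating it from any vertex ends in `R`, if it
admits a height function that decreases from each vertex to its parent. -/
def IsAcyclicParent {V R : Type*} (f : V → V ⊕ R) : Prop :=
  ∃ d : V → ℕ, ∀ v w, f v = Sum.inl w → d w < d v

/-- The parent function on `V` for which `s` is the set of children of the roots, with roots
prescribed by `a` on `s` and parents prescribed by `g` off `s`. -/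
def glueParent {V R : Type*} [DecidableEq V] (s : Finset V) (a : s → R)
    (g : {v // v ∉ s} → {v // v ∉ s} ⊕ s) (v : V) : V ⊕ R :=
  if h : v ∈ s then Sum.inr (a ⟨v, h⟩)
  else Sum.inl (Sum.elim Subtype.val Subtype.val (g ⟨v, h⟩))

lemma glueParent_isAcyclicParent {V R : Type*} [DecidableEq V] (s : Finset V) (a : s → R)
    {g : {v // v ∉ s} → {v // v ∉ s} ⊕ s} (hg : IsAcyclicParent g) :
    IsAcyclicParent (glueParent s a g) := by
  obtain ⟨d, hd⟩ := hg
  refine ⟨fun v => if h : v ∈ s then 0 else d ⟨v, h⟩ + 1, fun v w hvw => ?_⟩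
  unfold glueParent at hvw
  split_ifs at hvw with hv
  obtain h := Sum.inl_injective hvw
  rcases hgv : g ⟨v, hv⟩ with w' | w'
  · have := hd _ _ hgv
    rw [hgv] at h
    subst h
    simpa [hv, w'.2] using this
  · rw [hgv] at h
    subst h
    simp [hv]

lemma isRight_glueParent {V R : Type*} [DecidableEq V] (s : Finset V) (a : s → R)
    (g : {v // v ∉ s} → {v // v ∉ s} ⊕ s) (v : V) :
    (glueParent s a g v).isRight ↔ v ∈ s := by
  unfold glueParent
  split_ifs with h <;> simp [h]

/-- An acyclic parent function consists of the set `s` of children of the roots, the choice of a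
root for each element of `s`, and an acyclic parent function off `s` with `s` as its set of
roots. -/
lemma glueParent_bijective (V R : Type*) [Fintype V] [DecidableEq V] :
    Function.Bijective
      (fun x : (Σ s : Finset V, (s → R) ×
          {g : {v // v ∉ s} → {v // v ∉ s} ⊕ s // IsAcyclicParent g}) =>
        (⟨glueParent x.1 x.2.1 x.2.2.1, glueParent_isAcyclicParent _ _ x.2.2.2⟩ :
          {f : V → V ⊕ R // IsAcyclicParent f})) := by
  classical
  constructor
  · rintro ⟨s, a, g, hg⟩ ⟨t, b, k, hk⟩ h
    have h : glueParent s a g = glueParent t b k := congrArg Subtype.val h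
    obtain rfl : s = t := by
      ext v
      rw [← isRight_glueParent s a g, h, isRight_glueParent]
    obtain rfl : a = b := by
      funext v
      simpa [glueParent] using congrFun h v
    obtain rfl : g = k := by
      funext v
      have := congrFun h v
      simp only [glueParent, v.2, dite_false] at this
      have := Sum.inl_injective this
      rcases h1 : g v with x | x <;> rcases h2 : k v with y | y <;>
        simp only [h1, h2, Sum.elim_inl, Sum.elim_inr] at this
      · exact congrArg _ (Subtype.ext this)
      · exact absurd y.2 (this ▸ x.2)
      · exact absurd x.2 (this ▸ y.2)
      · exact congrArg _ (Subtype.ext this)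
    rfl
  · rintro ⟨f, d, hd⟩
    set s : Finset V := Finset.univ.filter fun v => (f v).isRight with hs
    have hl : ∀ v : {v // v ∉ s}, ∃ w, f v = Sum.inl w := by
      rintro ⟨v, hv⟩
      simpa [hs, Sum.isLeft_iff] using hv
    have hr : ∀ v : s, ∃ i, f v = Sum.inr i := by
      rintro ⟨v, hv⟩
      simpa [hs, Sum.isRight_iff] using hv
    choose p hp using hl
    choose a ha using hr
    refine ⟨⟨s, a, fun v => if h : p v ∈ s then Sum.inr ⟨p v, h⟩ else Sum.inl ⟨p v, h⟩,
      fun v => d v, fun v w hvw => ?_⟩, ?_⟩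
    · dsimp only at hvw ⊢
      split_ifs at hvw with h
      rw [← Sum.inl_injective hvw]
      exact hd _ _ (hp v)
    · ext1
      funext v
      by_cases hv : v ∈ s
      · simp only [glueParent, hv, dite_true]
        exact (ha ⟨v, hv⟩).symm
      · simp only [glueParent, hv, dite_false]
        rw [hp ⟨v, hv⟩]
        split_ifs <;> rfl

lemma sum_choose_mul_pow (r k : ℕ) :
    ∑ j ∈ Finset.range (k + 2), (k + 1).choose j * (r ^ j * (j * (k + 1) ^ (k + 1 - j)))
      = (k + 1) * (r * (r + (k + 1)) ^ k) := by
  rw [Finset.sum_range_succ', zero_mul, mul_zero, mul_zero, add_zero, add_pow r (k + 1) k,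
    Finset.mul_sum, Finset.mul_sum]
  refine Finset.sum_congr rfl fun j _ => ?_
  have h := Nat.add_one_mul_choose_eq k j
  rw [Nat.add_sub_add_right]
  calc _ = r ^ (j + 1) * (k + 1) ^ (k - j) * ((k + 1).choose (j + 1) * (j + 1)) := by ring
    _ = _ := by rw [← h]; push_cast; ring

/-- The number of acyclic parent functions on `n` vertices with `r` roots is `r * (r + n) ^ (n - 1)`,
stated without a negative exponent. By induction on `n`: if `j` vertices are children of roots, the
others carry an acyclic parent function with these `j` vertices as roots. -/
lemma card_isAcyclicParent_mul {n : ℕ} {V R : Type} [Fintype V] [Fintype R]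
    (hV : Fintype.card V = n) :
    Nat.card {f : V → V ⊕ R // IsAcyclicParent f} * (Fintype.card R + n)
      = Fintype.card R * (Fintype.card R + n) ^ n := by
  classical
  induction n using Nat.strong_induction_on generalizing V R with
  | _ n ih =>
  rcases n with _ | k
  · have : IsEmpty V := Fintype.card_eq_zero_iff.1 hV
    have : Nat.card {f : V → V ⊕ R // IsAcyclicParent f} = 1 :=
      Nat.card_eq_one_iff_unique.2 ⟨inferInstance,
        ⟨⟨isEmptyElim, fun _ => 0, fun v => isEmptyElim v⟩⟩⟩
    rw [this]
    simp
  · set r := Fintype.card R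
    suffices h : (k + 1) * Nat.card {f : V → V ⊕ R // IsAcyclicParent f}
        = (k + 1) * (r * (r + (k + 1)) ^ k) by
      rw [Nat.eq_of_mul_eq_mul_left k.succ_pos h, pow_succ, mul_assoc]
    rw [← sum_choose_mul_pow, ← Nat.card_eq_of_bijective _ (glueParent_bijective V R),
      Nat.card_sigma, Finset.mul_sum]
    have key : ∀ s : Finset V, (k + 1) * Nat.card ((s → R) ×
        {g : {v // v ∉ s} → {v // v ∉ s} ⊕ s // IsAcyclicParent g})
        = r ^ s.card * (s.card * (k + 1) ^ (k + 1 - s.card)) := by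
      intro s
      have hle : s.card ≤ k + 1 := hV ▸ s.card_le_univ
      have hc : Fintype.card {v // v ∉ s} = k + 1 - s.card := by
        rw [Fintype.card_subtype_compl, hV, Fintype.card_coe]
      rw [Nat.card_prod, Nat.card_eq_fintype_card, Fintype.card_fun, Fintype.card_coe]
      rcases s.eq_empty_or_nonempty with rfl | hs
      · -- Without children of roots there is no acyclic parent function.
        have : IsEmpty {g : {v // v ∉ (∅ : Finset V)} → {v // v ∉ (∅ : Finset V)} ⊕
            (∅ : Finset V) // IsAcyclicParent g} := by
          refine ⟨fun ⟨g, d, hd⟩ => ?_⟩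
          have : Nonempty {v // v ∉ (∅ : Finset V)} :=
            Fintype.card_pos_iff.1 (by rw [hc]; simp)
          obtain ⟨v, hv⟩ := Finite.exists_min d
          rcases h : g v with w | w
          · exact absurd (hd v w h) (hv w).not_gt
          · exact absurd w.2 (Finset.notMem_empty _)
        simp
      · have := ih (k + 1 - s.card) (by have := hs.card_pos; omega) (R := s) hc
        rw [Fintype.card_coe, Nat.add_sub_cancel' hle] at this
        rw [← this]
        ring
    rw [Finset.sum_congr rfl fun s _ => key s, ← Finset.powerset_univ,
      Finset.sum_powerset_apply_card (fun j => r ^ j * (j * (k + 1) ^ (k + 1 - j)))]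
    simp [hV]

/-! ### Trees as graphs with parents -/

namespace Graph

/-- `p` and `c` describe parents towards the root `r` in `T`: each vertex `v ≠ r` is joined to the
vertex `p v` by the edge `c v`, and some height function decreases from `v` to `p v`. The values
of `c` are optional because there is no edge to assign to the root (the edge type may be empty). -/
def IsParentStructure {α β : Type*} (T : Graph α β) (r : α) (p : α → α) (c : α → Option β) :
    Prop :=
  ∃ d : α → ℕ, ∀ v ∈ T.vertexSet, v ≠ r →
    ∃ e, c v = some e ∧ T.IsLink e v (p v) ∧ d (p v) < d v

lemma IsParentStructure.reflTransGen {α β : Type*} {T : Graph α β} {r : α} {p : α → α}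
    {c : α → Option β} (h : T.IsParentStructure r p c) {v : α} (hv : v ∈ T.vertexSet) :
    Relation.ReflTransGen T.Adj r v := by
  obtain ⟨d, hd⟩ := h
  induction hn : d v using Nat.strong_induction_on generalizing v with
  | _ n ih =>
  by_cases hvr : v = r
  · rw [hvr]
  · obtain ⟨e, -, hl, hlt⟩ := hd v hv hvr
    exact (ih _ (hn ▸ hlt) hl.right_mem rfl).tail hl.symm.adj

/-- If all edges lead from a vertex to its parent then the graph is a tree: the two edges of a
cycle at a vertex of maximal height would both lead to the parent of this vertex. -/
lemma IsParentStructure.isTree {α β : Type*} {T : Graph α β} {r : α} {p : α → α}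
    {c : α → Option β} (h : T.IsParentStructure r p c) (hr : r ∈ T.vertexSet)
    (hc : ∀ e ∈ T.edgeSet, ∃ v ∈ T.vertexSet, v ≠ r ∧ c v = some e) : T.IsTree := by
  have symm : Std.Symm T.Adj := ⟨fun _ _ h => h.symm⟩
  refine ⟨⟨⟨r, hr⟩, fun x hx y hy => ?_⟩, fun k v e ⟨_, he, hl⟩ => ?_⟩
  · exact (Std.Symm.symm (r := Relation.ReflTransGen T.Adj) _ _
      (h.reflTransGen hx)).trans (h.reflTransGen hy)
  · obtain ⟨d, hd⟩ := h
    obtain ⟨i, hi⟩ := Finite.exists_max fun i => d (v i)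
    have key : ∀ j w, T.IsLink (e j) (v i) w → d w ≤ d (v i) →
        c (v i) = some (e j) ∧ d w < d (v i) := by
      intro j w hw hle
      obtain ⟨u, hu, hur, heu⟩ := hc _ hw.edge_mem
      obtain ⟨e', he', hlu, hlt⟩ := hd u hu hur
      obtain rfl : e j = e' := Option.some_injective _ (heu.symm.trans he')
      rcases hw.eq_and_eq_or_eq_and_eq hlu with ⟨h1, h2⟩ | ⟨h1, h2⟩
      · exact ⟨by rw [← heu, h1], by rw [h1, h2]; exact hlt⟩
      · rw [h1, h2] at hle
        omega
    have h1 := key i _ (hl i) (hi _)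
    have h2 := hl (i - 1)
    rw [sub_add_cancel] at h2
    have h3 : i = i - 1 := he (Option.some_injective _
      (h1.1.symm.trans (key (i - 1) _ h2.symm (hi _)).1))
    have h4 : i + 1 = i := by
      conv_lhs => rw [h3]
      exact sub_add_cancel i 1
    rw [h4] at h1
    exact lt_irrefl _ h1.2

/-- A connected graph has parents towards any given vertex, by descent of the distance. -/
lemma IsConnected.exists_isParentStructure {α β : Type*} {T : Graph α β} (hT : T.IsConnected)
    {r : α} (hr : r ∈ T.vertexSet) : ∃ p c, T.IsParentStructure r p c := by
  classical
  -- `L n v` says that some walk of length `n` leads from `r` to `v`.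
  let L : ℕ → α → Prop := fun n => Nat.rec (fun v => v = r) (fun _ P v => ∃ w, P w ∧ T.Adj w v) n
  have hL : ∀ v ∈ T.vertexSet, ∃ n, L n v := by
    intro v hv
    have := hT.2 r hr v hv
    induction this with
    | refl => exact ⟨0, rfl⟩
    | tail _ hab ih =>
      obtain ⟨n, hn⟩ := ih hab.left_mem
      exact ⟨n + 1, _, hn, hab⟩
  let d : α → ℕ := fun v => sInf {n | L n v}
  have step : ∀ v, ∃ w c, v ∈ T.vertexSet → v ≠ r →
      ∃ e, c = some e ∧ T.IsLink e v w ∧ d w < d v := by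
    intro v
    by_cases hv : v ∈ T.vertexSet ∧ v ≠ r
    · have hmem : L (d v) v := Nat.sInf_mem (hL v hv.1)
      rcases hk : d v with _ | k
      · rw [hk] at hmem
        exact absurd hmem hv.2
      · rw [hk] at hmem
        obtain ⟨w, hw, e, he⟩ := hmem
        exact ⟨w, some e, fun _ _ => ⟨e, rfl, he.symm, Nat.lt_succ_of_le (Nat.sInf_le hw)⟩⟩
    · exact ⟨v, none, fun h1 h2 => absurd ⟨h1, h2⟩ hv⟩
  choose p c h using step
  exact ⟨p, c, d, h⟩

/-- In an acyclic graph every edge leads from a vertex to its parent: any other edge `xy` would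
close a cycle with the paths from `x` and `y` to their first common ancestor. -/
lemma IsParentStructure.exists_eq_some_of_isAcyclic {α β : Type*} {T : Graph α β} {r : α}
    {p : α → α} {c : α → Option β} (h : T.IsParentStructure r p c) (hr : r ∈ T.vertexSet)
    (hT : T.IsAcyclic) {e : β} (he : e ∈ T.edgeSet) :
    ∃ v ∈ T.vertexSet, v ≠ r ∧ c v = some e := by
  classical
  by_contra! hne
  obtain ⟨d, hd⟩ := h
  obtain ⟨x, y, hxy⟩ := exists_isLink_of_mem_edgeSet he
  -- Total versions of `p` and `c`; the root becomes its own parent, and its edge is irrelevant.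
  let q : α → α := fun v => if v = r then r else p v
  let b : α → β := fun v => (c v).getD e
  have hqr : ∀ n, q^[n] r = r := 
    fun n => Function.iterate_fixed (show q r = r from if_pos rfl) n
  have hq : ∀ v ∈ T.vertexSet, v ≠ r →
      T.IsLink (b v) v (q v) ∧ d (q v) < d v ∧ b v ≠ e := by
    intro v hv hvr
    obtain ⟨e', h1, h2, h3⟩ := hd v hv hvr
    have hb : b v = e' := by simp [b, h1]
    have hqv : q v = p v := if_neg hvr
    rw [hb, hqv]
    refine ⟨h2, h3, ?_⟩
    rintro rfl
    exact hne v hv hvr h1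
  have hmem : ∀ n, ∀ v ∈ T.vertexSet, q^[n] v ∈ T.vertexSet := by
    intro n
    induction n with
    | zero => exact fun v hv => hv
    | succ n ih =>
      intro v hv
      rw [Function.iterate_succ_apply]
      apply ih
      by_cases hvr : v = r
      · rw [hvr, show q r = r from hqr 1]
        exact hr
      · exact (hq v hv hvr).1.right_mem
  have hroot : ∀ v ∈ T.vertexSet, ∃ n, q^[n] v = r := by
    intro v hv
    induction hn : d v using Nat.strong_induction_on generalizing v with
    | _ n ih =>
    by_cases hvr : v = r
    · exact ⟨0, hvr⟩
    · obtain ⟨hl, hlt, -⟩ := hq v hv hvr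
      obtain ⟨k, hk⟩ := ih _ (hn ▸ hlt) _ hl.right_mem rfl
      exact ⟨k + 1, hk⟩
  have hb : ∀ v ∈ T.vertexSet, ∀ w ∈ T.vertexSet, v ≠ r → w ≠ r → b v = b w → v = w := by
    intro v hv w hw hvr hwr hvw
    obtain ⟨h1, h2, -⟩ := hq v hv hvr
    obtain ⟨h3, h4, -⟩ := hq w hw hwr
    rw [hvw] at h1
    rcases h1.eq_and_eq_or_eq_and_eq h3 with ⟨h5, -⟩ | ⟨h5, h6⟩
    · exact h5
    · rw [h6] at h2
      rw [← h5] at h4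
      omega
  have hx := hxy.left_mem
  have hy := hxy.right_mem
  -- `q^[i] x = q^[j] y` is the first common ancestor.
  have hex : ∃ i j, q^[i] x = q^[j] y := by
    obtain ⟨i, hi⟩ := hroot x hx
    obtain ⟨j, hj⟩ := hroot y hy
    exact ⟨i, j, hi.trans hj.symm⟩
  obtain ⟨i, hi, hxi⟩ : ∃ i, (∃ j, q^[i] x = q^[j] y) ∧ ∀ a < i, ∀ b, q^[a] x ≠ q^[b] y :=
    ⟨Nat.find hex, Nat.find_spec hex, fun a ha b hab => Nat.find_min hex ha ⟨b, hab⟩⟩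
  obtain ⟨j, hij, hyj⟩ : ∃ j, q^[i] x = q^[j] y ∧ ∀ b < j, q^[i] x ≠ q^[b] y :=
    ⟨Nat.find hi, Nat.find_spec hi, fun b hb => Nat.find_min hi hb⟩
  -- A repetition on the way to the ancestor would allow a shortcut.
  have short : ∀ z a b n, a < b → b ≤ n → q^[a] z = q^[b] z →
      ∃ m < n, q^[m] z = q^[n] z := by
    intro z a b n hab hbn heq
    refine ⟨n - b + a, by omega, ?_⟩
    rw [Function.iterate_add_apply, heq, ← Function.iterate_add_apply, Nat.sub_add_cancel hbn]
  have injx : ∀ a b, a ≤ i → b ≤ i → q^[a] x = q^[b] x → a = b := by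
    intro a b ha hb hab
    rcases lt_trichotomy a b with hlt | rfl | hlt
    · obtain ⟨m, hm, hmi⟩ := short x a b i hlt hb hab
      exact absurd (hmi.trans hij) (hxi m hm j)
    · rfl
    · obtain ⟨m, hm, hmi⟩ := short x b a i hlt ha hab.symm
      exact absurd (hmi.trans hij) (hxi m hm j)
  have injy : ∀ a b, a ≤ j → b ≤ j → q^[a] y = q^[b] y → a = b := by
    intro a b ha hb hab
    rcases lt_trichotomy a b with hlt | rfl | hlt
    · obtain ⟨m, hm, hmi⟩ := short y a b j hlt hb hab
      exact absurd (hij.trans hmi.symm) (hyj m hm)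
    · rfl
    · obtain ⟨m, hm, hmi⟩ := short y b a j hlt ha hab.symm
      exact absurd (hij.trans hmi.symm) (hyj m hm)
  have fixed : ∀ z a n, a ≤ n → q^[a] z = r → q^[n] z = r := by
    intro z a n han hz
    rw [← Nat.sub_add_cancel han, Function.iterate_add_apply, hz, hqr]
  have rootx : ∀ a < i, q^[a] x ≠ r := by
    intro a ha hz
    exact ha.ne (injx a i ha.le le_rfl (hz.trans (fixed x a i ha.le hz).symm))
  have rooty : ∀ a < j, q^[a] y ≠ r := by
    intro a ha hz
    exact ha.ne (injy a j ha.le le_rfl (hz.trans (fixed y a j ha.le hz).symm))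
  -- The cycle ascends from `x` to the ancestor, descends to `y` and returns along `e`.
  refine hT (i + j) (fun t => if t.1 ≤ i then q^[t.1] x else q^[i + j - t.1] y)
    (fun t => if t.1 < i then b (q^[t.1] x) else
      if t.1 < i + j then b (q^[i + j - t.1 - 1] y) else e) ⟨?_, ?_, ?_⟩
  · rintro ⟨t, ht⟩ ⟨s, hs⟩ hts
    ext
    dsimp only at hts ⊢
    split_ifs at hts with h1 h2 h2
    · exact injx t s h1 h2 hts
    · rcases h1.lt_or_eq with h1 | rfl
      · exact absurd hts (hxi _ h1 _)
      · exact absurd hts (hyj _ (by omega))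
    · rcases h2.lt_or_eq with h2 | rfl
      · exact absurd hts.symm (hxi _ h2 _)
      · exact absurd hts.symm (hyj _ (by omega))
    · have := injy _ _ (by omega) (by omega) hts
      omega
  · have bx : ∀ t < i, b (q^[t] x) ≠ e := fun t ht => (hq _ (hmem _ _ hx) (rootx t ht)).2.2
    have by' : ∀ t < j, b (q^[t] y) ≠ e := fun t ht => (hq _ (hmem _ _ hy) (rooty t ht)).2.2
    have bxy : ∀ t < i, ∀ s < j, b (q^[t] x) ≠ b (q^[s] y) := fun t ht s hs heq =>
      hxi t ht s (hb _ (hmem _ _ hx) _ (hmem _ _ hy) (rootx t ht) (rooty s hs) heq)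
    rintro ⟨t, ht⟩ ⟨s, hs⟩ hts
    ext
    dsimp only at hts ⊢
    split_ifs at hts with h1 h2 h3 h2 h3 h4 h4 h4
    · exact injx t s h1.le h2.le
        (hb _ (hmem _ _ hx) _ (hmem _ _ hx) (rootx t h1) (rootx s h2) hts)
    · exact absurd hts (bxy _ h1 _ (by omega))
    · exact absurd hts (bx _ h1)
    · exact absurd hts.symm (bxy _ h3 _ (by omega))
    · have := injy _ _ (by omega) (by omega) (hb _ (hmem _ _ hy) _ (hmem _ _ hy)
        (rooty (i + j - t - 1) (by omega)) (rooty (i + j - s - 1) (by omega)) hts)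
      omega
    · exact absurd hts (by' _ (by omega))
    · exact absurd hts.symm (bx _ (by assumption))
    · exact absurd hts.symm (by' _ (by omega))
    · omega
  · intro t
    induction t using Fin.lastCases with
    | last =>
      have h0 : (if i + j ≤ i then q^[i + j] x else q^[i + j - (i + j)] y) = y := by
        split_ifs with h1
        · obtain rfl : j = 0 := by omega
          exact hij
        · rw [Nat.sub_self, Function.iterate_zero_apply]
      rw [Fin.last_add_one]
      dsimp only [Fin.val_last, Fin.val_zero]
      rw [h0, if_neg (by omega), if_neg (lt_irrefl _)]
      simpa using hxy.symm
    | cast t =>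
      rw [Fin.coeSucc_eq_succ]
      obtain ⟨t, ht⟩ := t
      simp only [Fin.val_castSucc, Fin.val_succ, ht, if_true]
      by_cases h1 : t < i
      · rw [if_pos h1, if_pos h1.le, if_pos (show t + 1 ≤ i from h1),
          Function.iterate_succ_apply']
        exact (hq _ (hmem _ _ hx) (rootx t h1)).1
      · have h2 : (if t ≤ i then q^[t] x else q^[i + j - t] y) = q^[i + j - t - 1 + 1] y := by
          rw [Nat.sub_add_cancel (by omega)]
          split_ifs with h3
          · obtain rfl : t = i := by omega
            rw [hij, Nat.add_sub_cancel_left]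
          · rfl
        rw [if_neg h1, h2, if_neg (by omega), Function.iterate_succ_apply', ← Nat.sub_sub]
        exact (hq _ (hmem _ _ hy) (rooty (i + j - t - 1) (by omega))).1.symm

end Graph

/-! ### Spanning trees of the cone over a complete graph -/

namespace Graph

/-- The vertex of the cone represented by `y : Fin n ⊕ Fin m`, where all of `Fin m` represents the
apex. -/
def coneEnd {n m : ℕ} : Fin n ⊕ Fin m → Option (Fin n) :=
  Sum.elim some fun _ => none

/-- The edge of the cone from `v` to `y : Fin n ⊕ Fin m`; elements of `Fin m` stand for the parallel
edges to the apex. -/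
def coneEdge {n m : ℕ} (v : Fin n) : Fin n ⊕ Fin m → Sym2 (Fin n) ⊕ Fin n × Fin m :=
  Sum.elim (fun w => Sum.inl s(v, w)) fun i => Sum.inr (v, i)

lemma mem_vertexSet_cone {n m : ℕ} (x : Option (Fin n)) :
    x ∈ ((completeGraphOn n).generalizedCone m).vertexSet := by
  rcases x with _ | v
  · exact Or.inl rfl
  · exact Or.inr ⟨v, trivial, rfl⟩

lemma cone_isLink_some_iff {n m : ℕ} {v : Fin n} {e : Sym2 (Fin n) ⊕ Fin n × Fin m}
    {x : Option (Fin n)} :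
    ((completeGraphOn n).generalizedCone m).IsLink e (some v) x ↔
      ∃ y, y ≠ Sum.inl v ∧ e = coneEdge v y ∧ x = coneEnd y := by
  rcases e with e | ⟨a, i⟩
  · simp only [generalizedCone, completeGraphOn, ofSimpleGraph, coneEdge, coneEnd]
    constructor
    · rintro ⟨a, b, ⟨rfl, hab⟩, hv, rfl⟩
      obtain rfl := Option.some_injective _ hv
      exact ⟨Sum.inl b, fun h => hab (Sum.inl_injective h).symm, rfl, rfl⟩
    · rintro ⟨y | y, hy, he, rfl⟩
      · exact ⟨v, y, ⟨Sum.inl_injective he, by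
          rw [Sum.inl_injective he]; exact fun h => hy (congrArg _ h.symm)⟩, rfl, rfl⟩
      · simp at he
  · simp only [generalizedCone, completeGraphOn, ofSimpleGraph, coneEdge, coneEnd]
    constructor
    · rintro ⟨-, ⟨h, -⟩ | ⟨h, rfl⟩⟩
      · simp at h
      · obtain rfl := Option.some_injective _ h
        exact ⟨Sum.inr i, by simp, rfl, rfl⟩
    · rintro ⟨y | y, hy, he, rfl⟩
      · simp at he
      · obtain ⟨rfl, rfl⟩ := Prod.mk.inj (Sum.inr_injective he)
        exact ⟨trivial, Or.inr ⟨rfl, rfl⟩⟩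

/-- The spanning subgraph of the cone with the edges from the vertices to their parents. -/
def parentGraph {n m : ℕ} (f : Fin n → Fin n ⊕ Fin m) :
    Graph (Option (Fin n)) (Sym2 (Fin n) ⊕ Fin n × Fin m) :=
  ((completeGraphOn n).generalizedCone m).restrict (Set.range fun v => coneEdge v (f v))

lemma parentGraph_isSpanningSubgraph {n m : ℕ} (f : Fin n → Fin n ⊕ Fin m) :
    (parentGraph f).IsSpanningSubgraph ((completeGraphOn n).generalizedCone m) :=
  ⟨restrict_le, rfl⟩

lemma parentGraph_isLink {n m : ℕ} {f : Fin n → Fin n ⊕ Fin m} (hf : IsAcyclicParent f)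
    (v : Fin n) : (parentGraph f).IsLink (coneEdge v (f v)) (some v) (coneEnd (f v)) := by
  obtain ⟨d, hd⟩ := hf
  have : ((completeGraphOn n).generalizedCone m).IsLink
      (coneEdge v (f v)) (some v) (coneEnd (f v)) :=
    cone_isLink_some_iff.2 ⟨f v, fun h => lt_irrefl _ (hd v v h), rfl, rfl⟩
  simpa [parentGraph] using this

lemma parentGraph_edgeSet {n m : ℕ} {f : Fin n → Fin n ⊕ Fin m} (hf : IsAcyclicParent f) :
    (parentGraph f).edgeSet = Set.range fun v => coneEdge v (f v) := by
  refine Set.Subset.antisymm ?_ ?_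
  · intro e he
    obtain ⟨x, y, h⟩ := exists_isLink_of_mem_edgeSet he
    simp only [parentGraph, restrict_isLink] at h
    tauto
  · rintro _ ⟨v, rfl⟩
    exact (parentGraph_isLink hf v).edge_mem

lemma parentGraph_isSpanningTreeOf {n m : ℕ} {f : Fin n → Fin n ⊕ Fin m}
    (hf : IsAcyclicParent f) :
    (parentGraph f).IsSpanningTreeOf ((completeGraphOn n).generalizedCone m) := by
  refine ⟨parentGraph_isSpanningSubgraph f, ?_⟩
  have h : (parentGraph f).IsParentStructure none (fun x => x.bind fun v => coneEnd (f v))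
      (fun x => x.map fun v => coneEdge v (f v)) := by
    obtain ⟨d, hd⟩ := id hf
    refine ⟨fun x => x.elim 0 fun v => d v + 1, ?_⟩
    rintro (_ | v) - hv
    · exact absurd rfl hv
    · refine ⟨_, rfl, parentGraph_isLink hf v, ?_⟩
      rcases h : f v with w | i
      · simpa [coneEnd, h] using hd v w h
      · simp [coneEnd, h]
  refine h.isTree (mem_vertexSet_cone (m := m) _) fun e he => ?_
  rw [parentGraph_edgeSet hf] at he
  obtain ⟨v, rfl⟩ := he
  exact ⟨some v, mem_vertexSet_cone (m := m) _, by simp, rfl⟩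

lemma coneEdge_injective {n m : ℕ} (v : Fin n) : Function.Injective (coneEdge (m := m) v) := by
  rintro (a | a) (b | b) h <;> simp [coneEdge] at h ⊢ <;> grind

/-- An edge of the cone at two distinct vertices of `K_n` joins these two, so it has no end at the
apex. -/
lemma eq_inl_of_coneEdge_eq {n m : ℕ} {v w : Fin n} {y z : Fin n ⊕ Fin m}
    (h : coneEdge v y = coneEdge w z) (hvw : v ≠ w) : y = Sum.inl w ∧ z = Sum.inl v := by
  rcases y with y | y <;> rcases z with z | z <;> simp [coneEdge] at h ⊢
  · rcases h with h | h
    · exact absurd h.1 hvw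
    · exact ⟨h.2, h.1.symm⟩
  · exact hvw h.1

/-- An acyclic parent function is determined by its set of edges. By induction on the height of
`v` in `f`: if the edge from `v` to its parent `w` in `f` were not the edge from `v` to its parent
in `g`, it would be the edge from `w` to its parent in `g`, and hence in `f`. -/
lemma eq_of_parentGraph_eq {n m : ℕ} {f g : Fin n → Fin n ⊕ Fin m} (hf : IsAcyclicParent f)
    (hg : IsAcyclicParent g) (h : parentGraph f = parentGraph g) : f = g := by
  have hE := (parentGraph_edgeSet hf).symm.trans ((congrArg edgeSet h).trans
    (parentGraph_edgeSet hg))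
  obtain ⟨d, hd⟩ := hf
  funext v
  induction hn : d v using Nat.strong_induction_on generalizing v with
  | _ k ih =>
  obtain ⟨w, hw⟩ := hE.subset ⟨v, rfl⟩
  dsimp only at hw
  by_cases hvw : v = w
  · subst hvw
    exact coneEdge_injective v hw.symm
  · obtain ⟨h1, h2⟩ := eq_inl_of_coneEdge_eq hw.symm hvw
    have hlt := hd v w h1
    have h3 := ih _ (hn ▸ hlt) w rfl
    exact absurd (hd w v (h3.trans h2)) hlt.asymm

/-- Every spanning tree of the cone arises from an acyclic parent function. -/
lemma exists_parentGraph_eq {n m : ℕ} {T : Graph (Option (Fin n)) (Sym2 (Fin n) ⊕ Fin n × Fin m)}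
    (hT : T.IsSpanningTreeOf ((completeGraphOn n).generalizedCone m)) :
    ∃ f : Fin n → Fin n ⊕ Fin m, IsAcyclicParent f ∧ parentGraph f = T := by
  obtain ⟨hs, hconn, hacyc⟩ := hT
  have hV : ∀ x, x ∈ T.vertexSet := fun x => hs.vertexSet_eq ▸ mem_vertexSet_cone x
  obtain ⟨p, c, hpc⟩ := hconn.exists_isParentStructure (hV none)
  obtain ⟨d, hd⟩ := id hpc
  have step : ∀ v : Fin n, ∃ y, T.IsLink (coneEdge v y) (some v) (coneEnd y) ∧
      c (some v) = some (coneEdge v y) ∧ d (coneEnd y) < d (some v) := by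
    intro v
    obtain ⟨e, h1, h2, h3⟩ := hd (some v) (hV _) (by simp)
    obtain ⟨y, -, rfl, hy⟩ := cone_isLink_some_iff.1 (h2.mono hs.le)
    rw [hy] at h2 h3
    exact ⟨y, h2, h1, h3⟩
  choose f hl hc hlt using step
  have hf : IsAcyclicParent f := by
    refine ⟨fun v => d (some v), fun v w hvw => ?_⟩
    have := hlt v
    rwa [hvw] at this
  refine ⟨f, hf, (Compatible.of_le_le restrict_le hs.le).ext ?_ ?_⟩
  · exact hs.vertexSet_eq.symm
  · refine (parentGraph_edgeSet hf).trans ?_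
    refine Set.Subset.antisymm ?_ fun e he => ?_
    · rintro _ ⟨v, rfl⟩
      exact (hl v).edge_mem
    · obtain ⟨_ | v, -, h1, h2⟩ := hpc.exists_eq_some_of_isAcyclic (hV none) hacyc he
      · exact absurd rfl h1
      · exact ⟨v, Option.some_injective _ ((hc v).symm.trans h2)⟩

lemma numSpanningTrees_cone_completeGraphOn (m n : ℕ) :
    ((completeGraphOn n).generalizedCone m).numSpanningTrees
      = Nat.card {f : Fin n → Fin n ⊕ Fin m // IsAcyclicParent f} := by
  rw [numSpanningTrees, ← Nat.card_coe_set_eq]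
  refine (Nat.card_eq_of_bijective
    (fun f => ⟨parentGraph f.1, parentGraph_isSpanningTreeOf f.2⟩) ⟨?_, ?_⟩).symm
  · rintro ⟨f, hf⟩ ⟨g, hg⟩ h
    exact Subtype.ext (eq_of_parentGraph_eq hf hg (congrArg Subtype.val h))
  · rintro ⟨T, hT⟩
    obtain ⟨f, hf, rfl⟩ := exists_parentGraph_eq hT
    exact ⟨⟨f, hf⟩, rfl⟩

end Graph

theorem mainTheorem3 (m n : ℕ) (hm : 1 ≤ m) :
    (((Graph.completeGraphOn n).generalizedCone m).numSpanningTrees : ℚ)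
      = (m : ℚ) * ((m : ℚ) + (n : ℚ)) ^ ((n : ℤ) - 1) := by
  have h := card_isAcyclicParent_mul (R := Fin m) (Fintype.card_fin n)
  rw [Fintype.card_fin, ← Graph.numSpanningTrees_cone_completeGraphOn] at h
  have h0 : (m : ℚ) + n ≠ 0 := by positivity
  rw [zpow_sub_one₀ h0, zpow_natCast, ← mul_assoc, eq_mul_inv_iff_mul_eq₀ h0]
  exact_mod_cast h
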